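/- A paratopological group is a group $G$ with a Hausdorff topology $\tau$ making the multiplication $G\times G\to G$ continuous. Let $\tau^\flat$ be the strongest group topology on $G$ (i.e. topology, not necessarily Hausdorff, making $G$ a topological group) that is weaker than $\tau$. A subset of $G$ is $\flat$-closed if it is closed in $\tau^\flat$; $G$ is $\flat$-regular if each neighborhood of the unit contains a $\flat$-closed neighborhood of the unit. $G$ is saturated if for each nonempty open $U\subset G$ the set $U^{-1}$ has nonempty interior. $G$ is a SIN-group if each neighborhood $U$ of the unit contains a neighborhood $W$ of the unit with $gWg^{-1}\subset U$ for all $g\in G$. Let $H$ be a first-countable paratopological SIN-group. Then $H$ is $\flat$-regular if and only if $H$ is (topologically isomorphic to) a $\flat$-closed subgroup, with the subspace topology, of a regular first-countable saturated paratopological SIN-group $G$ with $|G/H|=\aleph_0$; here $\flat$-closed means closed in the topology $\tau_G^\flat$ of $G$. -/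

import Mathlib

open Set Topology
open scoped Pointwise Cardinal

universe u

namespace Paratop

/-- The group reflexion topology `τ^♭` of a group `G` with topology `τ`: the strongest (finest)
group topology on `G` that is weaker (coarser) than `τ`. In Mathlib's order on topologies `t ≤ s`
means that `t` is finer than `s`. See `isLeast_flatTopology`. -/
@[reducible] def flatTopology (G : Type u) [Group G] [τ : TopologicalSpace G] : TopologicalSpace G :=
  sInf {t : TopologicalSpace G | τ ≤ t ∧ @IsTopologicalGroup G t _}

/-- `τ^♭` is itself a group topology weaker than `τ`, and it is the finest one. -/
theorem isLeast_flatTopology (G : Type u) [Group G] [τ : TopologicalSpace G] :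
    IsLeast {t : TopologicalSpace G | τ ≤ t ∧ @IsTopologicalGroup G t _} (flatTopology G) :=
  ⟨⟨le_sInf fun _ ht => ht.1, topologicalGroup_sInf fun _ ht => ht.2⟩,
    fun _ ht => sInf_le ht⟩

/-- A subset of `G` is `♭`-closed if it is closed in the group reflexion topology of `G`. -/
def IsFlatClosed {G : Type u} [Group G] [TopologicalSpace G] (A : Set G) : Prop :=
  IsClosed[flatTopology G] A

/-- `G` is `♭`-regular if each neighborhood of the unit contains a `♭`-closed neighborhood of
the unit. -/
def IsFlatRegular (G : Type u) [Group G] [TopologicalSpace G] : Prop :=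
  ∀ U ∈ 𝓝 (1 : G), ∃ F ∈ 𝓝 (1 : G), IsFlatClosed F ∧ F ⊆ U

/-- `G` is saturated if the inverse of each nonempty open set has nonempty interior. -/
def IsSaturated (G : Type u) [Group G] [TopologicalSpace G] : Prop :=
  ∀ U : Set G, IsOpen U → U.Nonempty → (interior U⁻¹).Nonempty

/-- The SIN property: each neighborhood `U` of the unit contains a neighborhood `W` of the unit
such that `g W g⁻¹ ⊆ U` for all `g`. -/
def IsSIN (G : Type u) [Group G] [TopologicalSpace G] : Prop :=
  ∀ U ∈ 𝓝 (1 : G), ∃ W ∈ 𝓝 (1 : G), W ⊆ U ∧ ∀ g : G, ∀ w ∈ W, g * w * g⁻¹ ∈ U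

end Paratop

/-! Forward: choose a base of invariant ♭-closed sets `F n` at the unit of `H`, each containing the
square of the next. Put `N k = F k * (F k)⁻¹` and retopologize `H × ℚ`. A basic neighborhood of the
unit has slice `F n` at height `0`; at a height `t` with `0 < t < 2⁻ⁿ` this is enlarged by the sets
`N (n + j)` with `2⁻ʲ ≤ t`. The symmetric sets `N` put inverses of small elements into the upper
slices, whence saturation (`inv_mem_coneNhds`). The enlargement vanishes as `t → 0`, so ♭-closedness
of `F n` yields regularity (`mem_coneNhds_of_forall`). `H` is the kernel of a continuous projection
to `ℚ`, hence ♭-closed of countable index. Converse: regular saturated SIN-groups are ♭-regular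
(`IsSaturated.isFlatRegular`), and ♭-closed sets pull back along continuous homomorphisms. -/

open Filter

namespace Paratop

/-! ### Topologies defined by invariant sequences -/

section General

variable {G : Type u} [Group G]

/-- A sequence of conjugation-invariant sets containing the unit, each of which contains the square
of its successor. -/
structure IsInvariantSeq (W : ℕ → Set G) : Prop where
  one_mem : ∀ n, 1 ∈ W n
  mul_mem : ∀ {n a b}, a ∈ W (n + 1) → b ∈ W (n + 1) → a * b ∈ W n
  conj_mem : ∀ {n a} (g : G), a ∈ W n → g * a * g⁻¹ ∈ W n

namespace IsInvariantSeq

variable {W : ℕ → Set G}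

theorem antitone (hW : IsInvariantSeq W) : Antitone W :=
  antitone_nat_of_succ_le fun n a ha => by simpa using hW.mul_mem ha (hW.one_mem (n + 1))

theorem mem_of_le (hW : IsInvariantSeq W) {m n : ℕ} (h : m ≤ n) {a : G} (ha : a ∈ W n) : a ∈ W m :=
  hW.antitone h ha

theorem conj_mem' (hW : IsInvariantSeq W) {n : ℕ} {a : G} (g : G) (ha : a ∈ W n) :
    g⁻¹ * a * g ∈ W n := by
  simpa using hW.conj_mem g⁻¹ ha

/-- The topology in which the translates of the sets `W n` form neighborhood bases. -/
@[reducible] def topology (_ : IsInvariantSeq W) : TopologicalSpace G :=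
  .mkOfNhds fun x => ⨅ n, 𝓟 {y | x⁻¹ * y ∈ W n}

theorem hasBasis_nhds (hW : IsInvariantSeq W) (x : G) :
    (@nhds G hW.topology x).HasAntitoneBasis fun n => {y | x⁻¹ * y ∈ W n} := by
  have hb : ∀ x : G, (⨅ n, 𝓟 {y | x⁻¹ * y ∈ W n}).HasAntitoneBasis
      fun n => {y | x⁻¹ * y ∈ W n} := fun x =>
    .iInf_principal fun m n h y hy => hW.mem_of_le h hy
  rw [topology, TopologicalSpace.nhds_mkOfNhds_of_hasBasis (fun a => (hb a).toHasBasis)]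
  · exact hb x
  · intro a n _
    simpa using hW.one_mem n
  · intro a n _
    refine (hb a).mem_iff.2 ⟨n + 1, fun y hy => (hb y).mem_iff.2 ⟨n + 1, fun z hz => ?_⟩⟩
    simpa [mul_assoc] using hW.mul_mem hy hz

theorem hasBasis_nhds_one (hW : IsInvariantSeq W) :
    (@nhds G hW.topology 1).HasAntitoneBasis W := by
  simpa using hW.hasBasis_nhds 1

theorem continuousMul (hW : IsInvariantSeq W) : @ContinuousMul G hW.topology _ := by
  let := hW.topology
  refine ⟨continuous_iff_continuousAt.2 fun ⟨x, y⟩ => ?_⟩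
  rw [ContinuousAt, nhds_prod_eq]
  refine (((hW.hasBasis_nhds x).prod (hW.hasBasis_nhds y)).tendsto_iff
    (hW.hasBasis_nhds _).toHasBasis).2 fun n _ => ⟨n + 1, trivial, fun ⟨a, b⟩ ⟨ha, hb⟩ => ?_⟩
  have := hW.mul_mem (hW.conj_mem' y ha) hb
  simpa [mul_assoc] using this

theorem firstCountableTopology (hW : IsInvariantSeq W) :
    @FirstCountableTopology G hW.topology :=
  let := hW.topology
  ⟨fun x => (hW.hasBasis_nhds x).isCountablyGenerated⟩

theorem isSIN (hW : IsInvariantSeq W) : @IsSIN G _ hW.topology := by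
  let := hW.topology
  intro U hU
  obtain ⟨n, hn⟩ := hW.hasBasis_nhds_one.mem_iff.1 hU
  exact ⟨W n, hW.hasBasis_nhds_one.mem n, hn, fun g w hw => hn (hW.conj_mem g hw)⟩

theorem t0Space (hW : IsInvariantSeq W) (h : ∀ g, (∀ n, g ∈ W n) → g = 1) :
    @T0Space G hW.topology := by
  let := hW.topology
  refine ⟨fun x y hxy => ?_⟩
  refine (inv_mul_eq_one.1 (h (x⁻¹ * y) fun n => ?_))
  have h : {z | x⁻¹ * z ∈ W n} ∈ 𝓝 y := hxy.nhds_eq ▸ (hW.hasBasis_nhds x).mem n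
  have hy : y ∈ {z | x⁻¹ * z ∈ W n} := mem_of_mem_nhds h
  exact hy

/-- The hypothesis says that the closure of `W m` lies in `W n`: `g` is in that closure when every
`g W k` meets `W m`. -/
theorem regularSpace (hW : IsInvariantSeq W)
    (h : ∀ n, ∃ m, ∀ g, (∀ k, ∃ w ∈ W k, g * w ∈ W m) → g ∈ W n) :
    @RegularSpace G hW.topology := by
  let := hW.topology
  refine .of_exists_mem_nhds_isClosed_subset fun x U hU => ?_
  obtain ⟨n, hn⟩ := (hW.hasBasis_nhds x).mem_iff.1 hU
  obtain ⟨m, hm⟩ := h n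
  refine ⟨closure {y | x⁻¹ * y ∈ W m},
    mem_of_superset ((hW.hasBasis_nhds x).mem m) subset_closure, isClosed_closure,
    fun y hy => hn (hm _ fun k => ?_)⟩
  obtain ⟨z, hz, hz'⟩ := mem_closure_iff_nhds.1 hy _ ((hW.hasBasis_nhds y).mem k)
  exact ⟨y⁻¹ * z, hz, by simpa [mul_assoc] using hz'⟩

theorem isSaturated (hW : IsInvariantSeq W)
    (h : ∀ n, ∃ m p, ∀ w ∈ W m, (p * w)⁻¹ ∈ W n) : @IsSaturated G _ hW.topology := by
  let := hW.topology
  rintro U hU ⟨g, hg⟩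
  obtain ⟨n, hn⟩ := (hW.hasBasis_nhds g).mem_iff.1 (hU.mem_nhds hg)
  obtain ⟨m, p, hp⟩ := h n
  refine ⟨p * g⁻¹, mem_interior_iff_mem_nhds.2 <|
    (hW.hasBasis_nhds _).mem_iff.2 ⟨m, fun y hy => hn ?_⟩⟩
  have := hp _ (hW.conj_mem' g hy)
  simpa [mul_assoc] using this

/-- The sets `W n * (W n)⁻¹` attached to an invariant sequence form an invariant sequence. -/
theorem mul_inv (hW : IsInvariantSeq W) : IsInvariantSeq fun n => W n * (W n)⁻¹ where
  one_mem n := ⟨1, hW.one_mem n, 1, by simpa using hW.one_mem n, by simp⟩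
  mul_mem := by
    rintro n _ _ ⟨a, ha, b, hb, rfl⟩ ⟨c, hc, d, hd, rfl⟩
    -- Conjugation moves `c` past `b`: `(a b)(c d) = a (b c b⁻¹) · (b d)`.
    refine ⟨a * (b * c * b⁻¹), hW.mul_mem ha (hW.conj_mem b hc), b * d, ?_, by simp [mul_assoc]⟩
    rw [Set.mem_inv] at hb hd ⊢
    simpa using hW.mul_mem hd hb
  conj_mem := by
    rintro n _ g ⟨a, ha, b, hb, rfl⟩
    refine ⟨g * a * g⁻¹, hW.conj_mem g ha, g * b * g⁻¹, ?_, by simp [mul_assoc]⟩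
    rw [Set.mem_inv] at hb ⊢
    simpa [mul_assoc] using hW.conj_mem g hb

end IsInvariantSeq

/-! ### The group reflexion and ♭-regularity -/

section Flat

variable [τ : TopologicalSpace G]

theorem flatTopology_le {t : TopologicalSpace G} (h : τ ≤ t)
    (ht : @IsTopologicalGroup G t _) : @flatTopology G _ τ ≤ t :=
  (@isLeast_flatTopology G _ τ).2 ⟨h, ht⟩

theorem isTopologicalGroup_flatTopology : @IsTopologicalGroup G (flatTopology G) _ :=
  (isLeast_flatTopology G).1.2

theorem le_flatTopology : τ ≤ flatTopology G :=
  (isLeast_flatTopology G).1.1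

theorem _root_.IsClosed.isFlatClosed [hG : IsTopologicalGroup G] {A : Set G} (hA : IsClosed A) :
    IsFlatClosed A :=
  hA.mono (flatTopology_le le_rfl hG)

/-- The preimage of a `♭`-closed set under a continuous homomorphism is `♭`-closed. -/
theorem IsFlatClosed.preimage {H : Type*} [Group H] [TopologicalSpace H] {A : Set G}
    (hA : IsFlatClosed A) (φ : H →* G) (hφ : Continuous φ) : IsFlatClosed (φ ⁻¹' A) := by
  have h : flatTopology H ≤ (flatTopology G).induced φ := by
    refine flatTopology_le ?_ ?_
    · exact (continuous_iff_le_induced.1 hφ).trans (induced_mono le_flatTopology)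
    · exact @topologicalGroup_induced G H (flatTopology G) _ isTopologicalGroup_flatTopology
        _ _ _ _ φ
  exact IsClosed.mono ((@isClosed_induced_iff _ _ (flatTopology G) _ _).2 ⟨A, hA, rfl⟩) h

theorem IsFlatRegular.of_isInducing {H : Type*} [Group H] [TopologicalSpace H]
    (hG : IsFlatRegular G) (φ : H →* G) (hφ : IsInducing φ) : IsFlatRegular H := by
  intro U hU
  rw [hφ.nhds_eq_comap, map_one] at hU
  obtain ⟨V, hV, hVU⟩ := hU
  obtain ⟨F, hF, hFc, hFV⟩ := hG V hV
  refine ⟨φ ⁻¹' F, ?_, hFc.preimage φ hφ.continuous, (preimage_mono hFV).trans hVU⟩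
  rw [hφ.nhds_eq_comap, map_one]
  exact preimage_mem_comap hF

/-- If every neighborhood `V` of the unit admits a point of `F` in `x V V⁻¹`, then `x` lies
in the `♭`-closure of `F`. -/
theorem IsFlatClosed.mem_of_forall {F : Set G} (hF : IsFlatClosed F) {x : G}
    (h : ∀ V ∈ 𝓝 (1 : G), ∃ a ∈ V, ∃ b ∈ V, x * (a * b⁻¹) ∈ F) : x ∈ F := by
  have hle := nhds_mono (le_flatTopology (G := G)) (a := 1)
  have hgroup := isTopologicalGroup_flatTopology (G := G)
  let := flatTopology G
  rw [← IsClosed.closure_eq hF, mem_closure_iff_nhds]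
  intro M hM
  have ht : Tendsto (fun p : G × G => x * (p.1 * p.2⁻¹)) (𝓝 1 ×ˢ 𝓝 1) (𝓝 x) := by
    rw [← nhds_prod_eq]
    have : Continuous fun p : G × G => x * (p.1 * p.2⁻¹) := by fun_prop
    simpa using this.tendsto (1, 1)
  obtain ⟨V, hV, hVM⟩ := mem_prod_same_iff.1 (ht hM)
  obtain ⟨a, ha, b, hb, hab⟩ := h V (hle hV)
  exact ⟨_, hVM (mk_mem_prod ha hb), hab⟩

theorem IsSIN.exists_invariant (hG : IsSIN G) {U : Set G} (hU : U ∈ 𝓝 1) :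
    {a | ∀ g : G, g * a * g⁻¹ ∈ U} ∈ 𝓝 1 := by
  obtain ⟨W, hW, -, h⟩ := hG U hU
  exact mem_of_superset hW fun w hw g => h g w hw

variable [ContinuousMul G]

theorem exists_nhds_one_mul_mem {U : Set G} (hU : U ∈ 𝓝 1) :
    ∃ V ∈ 𝓝 (1 : G), ∀ a ∈ V, ∀ b ∈ V, a * b ∈ U := by
  obtain ⟨V, hV, h⟩ := exists_open_nhds_one_mul_subset hU
  exact ⟨V, hV.mem_nhds h.1, fun a ha b hb => h.2 (mul_mem_mul ha hb)⟩

theorem mem_nhds_iff_left_translate {x : G} {U : Set G} :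
    U ∈ 𝓝 x ↔ (x * ·) ⁻¹' U ∈ 𝓝 1 := by
  have h : map (x * ·) (𝓝 1) = 𝓝 x := by simpa using (Homeomorph.mulLeft x).map_nhds_eq 1
  rw [← h, mem_map]

/-- In a paratopological SIN-group the sets `V V⁻¹` form a base of a group topology. -/
@[reducible] def IsSIN.filterBasis (hG : IsSIN G) : GroupFilterBasis G where
  sets := {N | ∃ V ∈ 𝓝 (1 : G), (∀ g : G, ∀ a ∈ V, g * a * g⁻¹ ∈ V) ∧ N = V * V⁻¹}
  nonempty := ⟨_, univ, univ_mem, by simp, rfl⟩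
  inter_sets := by
    rintro _ _ ⟨V, hV, hVc, rfl⟩ ⟨V', hV', hVc', rfl⟩
    refine ⟨_, ⟨V ∩ V', inter_mem hV hV', fun g a ha => ⟨hVc g a ha.1, hVc' g a ha.2⟩, rfl⟩, ?_⟩
    exact subset_inter (mul_subset_mul inter_subset_left (inv_subset_inv.2 inter_subset_left))
      (mul_subset_mul inter_subset_right (inv_subset_inv.2 inter_subset_right))
  one' := by
    rintro _ ⟨V, hV, -, rfl⟩
    exact ⟨1, mem_of_mem_nhds hV, 1, by simpa using mem_of_mem_nhds hV, by simp⟩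
  mul' := by
    rintro _ ⟨V, hV, hVc, rfl⟩
    obtain ⟨U, hU, h⟩ := exists_nhds_one_mul_mem hV
    refine ⟨_, ⟨_, hG.exists_invariant hU, fun g a ha g' => ?_, rfl⟩, ?_⟩
    · simpa [mul_assoc] using ha (g' * g)
    rintro _ ⟨_, ⟨a, ha, b, hb, rfl⟩, _, ⟨c, hc, d, hd, rfl⟩, rfl⟩
    refine ⟨a * (b * c * b⁻¹), h _ (by simpa using ha 1) _ (hc b), b * d, ?_, by simp [mul_assoc]⟩
    rw [Set.mem_inv]
    simpa using h _ (hd 1) _ (hb 1)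
  inv' := by
    rintro _ ⟨V, hV, hVc, rfl⟩
    refine ⟨_, ⟨V, hV, hVc, rfl⟩, fun x hx => ?_⟩
    rw [mem_preimage, ← Set.mem_inv]
    simpa using hx
  conj' := by
    rintro g _ ⟨V, hV, hVc, rfl⟩
    refine ⟨_, ⟨V, hV, hVc, rfl⟩, ?_⟩
    rintro _ ⟨a, ha, b, hb, rfl⟩
    refine ⟨g * a * g⁻¹, hVc g a ha, g * b * g⁻¹, ?_, by simp [mul_assoc]⟩
    rw [Set.mem_inv] at hb ⊢
    simpa [mul_assoc] using hVc g _ hb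

/-- In a paratopological SIN-group every point of a `♭`-closure is approximated along the sets
`V V⁻¹`. -/
theorem IsSIN.exists_mem_of_mem_closure (hG : IsSIN G) {A : Set G} {x : G}
    (hx : x ∈ @closure G (flatTopology G) A) {V : Set G} (hV : V ∈ 𝓝 1) :
    ∃ a ∈ V, ∃ b ∈ V, x * (a * b⁻¹) ∈ A := by
  have hle : τ ≤ hG.filterBasis.topology := by
    intro U hU
    refine isOpen_iff_mem_nhds.2 fun y hy => mem_nhds_iff_left_translate.2 ?_
    obtain ⟨_, ⟨V, hV, -, rfl⟩, h⟩ := (hG.filterBasis.nhds_hasBasis y).mem_iff.1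
      (@IsOpen.mem_nhds _ hG.filterBasis.topology _ _ hU hy)
    refine mem_of_superset hV fun v hv => h ⟨v, ⟨v, hv, 1, ?_, by simp⟩, rfl⟩
    simpa using mem_of_mem_nhds hV
  -- The `V V⁻¹` topology is a group topology weaker than `τ`, hence weaker than `τ^♭`, so its
  -- closures are larger.
  have hx' : x ∈ @closure G hG.filterBasis.topology A := fun C hC => hx C
    ⟨hC.1.mono (flatTopology_le hle hG.filterBasis.isTopologicalGroup), hC.2⟩
  obtain ⟨_, ⟨_, ⟨a, ha, b, hb, rfl⟩, rfl⟩, hA⟩ :=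
    (@mem_closure_iff_nhds_basis' _ hG.filterBasis.topology _ _ _ _ _
      (hG.filterBasis.nhds_hasBasis x)).1 hx' _
      ⟨_, hG.exists_invariant hV, fun g a ha g' => by simpa [mul_assoc] using ha (g' * g), rfl⟩
  refine ⟨a, by simpa using ha 1, b⁻¹, by simpa using hb 1, by simpa using hA⟩

/-- Regular saturated paratopological SIN-groups are `♭`-regular. -/
theorem IsSaturated.isFlatRegular [RegularSpace G] (hs : IsSaturated G) (hG : IsSIN G) :
    IsFlatRegular G := by
  intro U hU
  obtain ⟨C, hC, hCc, hCU⟩ := exists_mem_nhds_isClosed_subset hU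
  obtain ⟨V, hV, hVC⟩ := exists_nhds_one_mul_mem hC
  refine ⟨@closure G (flatTopology G) V, mem_of_superset hV (@subset_closure _ (flatTopology G) _),
    @isClosed_closure _ (flatTopology G) _, fun x hx => hCU ?_⟩
  rw [← hCc.closure_eq, mem_closure_iff_nhds]
  intro M hM
  obtain ⟨W, hW, hWV⟩ := exists_nhds_one_mul_mem
    (inter_mem hV (mem_nhds_iff_left_translate.1 hM))
  -- Saturation gives `s⁻¹ ∈ W` with `(s a)⁻¹ ∈ W` for all `a` near the unit. Then `x s⁻¹ ∈ M`, and
  -- `x s⁻¹ = (x a b⁻¹)(b a⁻¹ s⁻¹) ∈ V V ⊆ C`.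
  obtain ⟨s, hs⟩ := hs (interior W) isOpen_interior ⟨1, mem_interior_iff_mem_nhds.2 hW⟩
  have hs' := mem_nhds_iff_left_translate.1 (mem_interior_iff_mem_nhds.1 hs)
  have hsW : s⁻¹ ∈ W := interior_subset (Set.mem_inv.1 (interior_subset hs))
  obtain ⟨a, ha, b, hb, hab⟩ := hG.exists_mem_of_mem_closure hx (inter_mem hW hs')
  have h1 : a⁻¹ * s⁻¹ ∈ W := by simpa using interior_subset ha.2
  refine ⟨x * s⁻¹, ?_, ?_⟩
  · simpa using (hWV _ hsW _ (mem_of_mem_nhds hW)).2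
  · simpa [mul_assoc] using hVC _ hab _ (hWV _ hb.1 _ h1).1

end Flat

end General

/-! ### Invariant ♭-closed bases -/

section Basis

variable {H : Type u} [Group H] [TopologicalSpace H] [ContinuousMul H]

/-- In a `♭`-regular SIN-group the conjugation-invariant `♭`-closed neighborhoods of the unit form
a base. -/
theorem IsFlatRegular.exists_invariant (hreg : IsFlatRegular H) (hSIN : IsSIN H) {U : Set H}
    (hU : U ∈ 𝓝 1) :
    ∃ F ∈ 𝓝 (1 : H), IsFlatClosed F ∧ (∀ g : H, ∀ a ∈ F, g * a * g⁻¹ ∈ F) ∧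
      ∀ a ∈ F, ∀ b ∈ F, a * b ∈ U := by
  obtain ⟨V, hV, hVU⟩ := exists_nhds_one_mul_mem hU
  obtain ⟨E, hE, hEc, hEV⟩ := hreg V hV
  refine ⟨{a | ∀ g : H, g * a * g⁻¹ ∈ E}, hSIN.exists_invariant hE, ?_,
    fun g a ha g' => by simpa [mul_assoc] using ha (g' * g),
    fun a ha b hb => hVU a (hEV (by simpa using ha 1)) b (hEV (by simpa using hb 1))⟩
  have hgroup := isTopologicalGroup_flatTopology (G := H)
  unfold IsFlatClosed at hEc ⊢
  let := flatTopology H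
  rw [Set.ofPred_forall]
  exact isClosed_iInter fun g => hEc.preimage (by fun_prop : Continuous fun a => g * a * g⁻¹)

theorem IsFlatRegular.exists_invariantSeq [FirstCountableTopology H] (hreg : IsFlatRegular H)
    (hSIN : IsSIN H) :
    ∃ F : ℕ → Set H, IsInvariantSeq F ∧ (𝓝 1).HasAntitoneBasis F ∧ ∀ n, IsFlatClosed (F n) := by
  obtain ⟨U, hU⟩ := (𝓝 (1 : H)).exists_antitone_basis
  choose f hf hfc hfi hfm using
    fun V : {V : Set H // V ∈ 𝓝 (1 : H)} => hreg.exists_invariant hSIN V.2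
  -- Each term stays bundled as a neighborhood so that `f` applies again; intersecting with `U (n +
  -- 1)` makes the sequence a base.
  let F : ℕ → {V : Set H // V ∈ 𝓝 (1 : H)} := fun n =>
    Nat.rec (motive := fun _ => {V : Set H // V ∈ 𝓝 (1 : H)}) ⟨f ⟨U 0, hU.mem 0⟩, hf _⟩
      (fun n V => ⟨f ⟨V.1 ∩ U (n + 1), inter_mem V.2 (hU.mem _)⟩, hf _⟩) n
  have hF : ∀ n, ∃ V : {V : Set H // V ∈ 𝓝 (1 : H)}, (F n).1 = f V ∧ V.1 ⊆ U n := by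
    rintro (_ | n)
    · exact ⟨⟨U 0, hU.mem 0⟩, rfl, subset_rfl⟩
    · exact ⟨⟨(F n).1 ∩ U (n + 1), inter_mem (F n).2 (hU.mem _)⟩, rfl, inter_subset_right⟩
  have hFU : ∀ n, (F n).1 ⊆ U n := fun n a ha => by
    obtain ⟨V, hV, hVU⟩ := hF n
    rw [hV] at ha
    simpa using hVU (hfm V a ha 1 (mem_of_mem_nhds (hf V)))
  have hinv : IsInvariantSeq fun n => (F n).1 :=
    { one_mem := fun n => mem_of_mem_nhds (F n).2
      mul_mem := fun ha hb => (hfm _ _ ha _ hb).1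
      conj_mem := fun {n a} g ha => by
        obtain ⟨V, hV, -⟩ := hF n
        simp only [hV] at ha ⊢
        exact hfi V g a ha }
  refine ⟨fun n => (F n).1, hinv, ⟨⟨fun s => ?_⟩, hinv.antitone⟩, fun n => ?_⟩
  · rw [hU.mem_iff]
    refine ⟨fun ⟨n, hn⟩ => ⟨n, trivial, (hFU n).trans hn⟩, fun ⟨n, _, hn⟩ => ?_⟩
    exact hU.mem_iff.1 (mem_of_superset (F n).2 hn)
  · obtain ⟨V, hV, -⟩ := hF n
    simpa only [hV] using hfc V

end Basis

/-! ### The cone topology on `H × ℚ` -/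

section Extension

variable {H : Type u} [Group H] (F : ℕ → Set H)

/-- The sets `N (n + j)` with `N k = F k * (F k)⁻¹` and `2⁻ʲ ≤ t`; only the unit if `t = 0`. -/
def scaledBall (n : ℕ) (t : ℚ) : Set H :=
  {b | (t = 0 ∧ b = 1) ∨ ∃ j : ℕ, (1 / 2 : ℚ) ^ j ≤ t ∧ b ∈ F (j + n) * (F (j + n))⁻¹}

/-- A base at the unit of `H × ℚ` which induces the sets `F n` on `H` and is spread out along the
group reflexion of `H` in the direction of positive rationals. -/
def coneNhds (n : ℕ) : Set (H × Multiplicative ℚ) :=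
  {g | 0 ≤ g.2.toAdd ∧ g.2.toAdd < (1 / 2) ^ n ∧
    ∃ a ∈ F n, ∃ b ∈ scaledBall F n g.2.toAdd, g.1 = a * b}

variable {F}

theorem inv_mem_mul_inv {A : Set H} {a : H} (ha : a ∈ A * A⁻¹) : a⁻¹ ∈ A * A⁻¹ := by
  rw [← Set.mem_inv]
  simpa using ha

theorem IsInvariantSeq.scaledBall_subset (hF : IsInvariantSeq F) (n : ℕ) (t : ℚ) :
    scaledBall F n t ⊆ F n * (F n)⁻¹ := by
  rintro b (⟨-, rfl⟩ | ⟨j, -, hb⟩)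
  · exact hF.mul_inv.one_mem n
  · exact hF.mul_inv.mem_of_le (Nat.le_add_left n j) hb

/-- The larger ball absorbs the smaller at the cost of one index, and its radius bound survives
because `s, t ≤ s + t`. -/
theorem IsInvariantSeq.scaledBall_mul (hF : IsInvariantSeq F) {n : ℕ} {s t : ℚ} (hs : 0 ≤ s)
    (ht : 0 ≤ t) {a b : H} (ha : a ∈ scaledBall F (n + 1) s) (hb : b ∈ scaledBall F (n + 1) t) :
    a * b ∈ scaledBall F n (s + t) := by
  have hN := hF.mul_inv
  rcases ha with ⟨rfl, rfl⟩ | ⟨j, hj, ha⟩ <;> rcases hb with ⟨rfl, rfl⟩ | ⟨k, hk, hb⟩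
  · exact .inl (by simp)
  · exact .inr ⟨k, by simpa using hk, by simpa using hN.mem_of_le (by omega) hb⟩
  · exact .inr ⟨j, by simpa using hj, by simpa using hN.mem_of_le (by omega) ha⟩
  · rcases le_total j k with h | h
    · exact .inr ⟨j, by linarith, hN.mul_mem ha (hN.mem_of_le (by omega) hb)⟩
    · exact .inr ⟨k, by linarith, hN.mul_mem (hN.mem_of_le (by omega) ha) hb⟩

theorem IsInvariantSeq.scaledBall_conj (hF : IsInvariantSeq F) {n : ℕ} {t : ℚ} {b : H} (g : H)
    (hb : b ∈ scaledBall F n t) : g * b * g⁻¹ ∈ scaledBall F n t := by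
  rcases hb with ⟨rfl, rfl⟩ | ⟨j, hj, hb⟩
  · exact .inl (by simp)
  · exact .inr ⟨j, hj, hF.mul_inv.conj_mem g hb⟩

theorem IsInvariantSeq.coneNhds (hF : IsInvariantSeq F) : IsInvariantSeq (coneNhds F) where
  one_mem n := ⟨le_rfl, by simp, 1, hF.one_mem n, 1, .inl (by simp), by simp⟩
  mul_mem := by
    rintro n ⟨_, s⟩ ⟨_, t⟩ ⟨hs, hs', a, ha, b, hb, rfl⟩ ⟨ht, ht', c, hc, d, hd, rfl⟩
    -- Here `(a b)(c d) = (a c)(c⁻¹ b c) d`.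
    refine ⟨add_nonneg hs ht, ?_, a * c, hF.mul_mem ha hc, c⁻¹ * b * c * d, ?_, ?_⟩
    · simp only [Prod.mk_mul_mk, toAdd_mul] at *
      rw [pow_succ] at hs' ht'
      linarith
    · refine hF.scaledBall_mul hs ht ?_ hd
      simpa using hF.scaledBall_conj c⁻¹ hb
    · simp [mul_assoc]
  conj_mem := by
    rintro n ⟨_, t⟩ ⟨g, s⟩ ⟨ht, ht', a, ha, b, hb, rfl⟩
    have h : ((g, s) * (a * b, t) * (g, s)⁻¹).2 = t := by simp
    refine ⟨by rwa [h], by rwa [h], g * a * g⁻¹, hF.conj_mem g ha, g * b * g⁻¹, ?_, ?_⟩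
    · rw [h]
      exact hF.scaledBall_conj g hb
    · simp [mul_assoc]

theorem IsInvariantSeq.fst_mem_of_mem_coneNhds (hF : IsInvariantSeq F) {n : ℕ}
    {g : H × Multiplicative ℚ} (hg : g ∈ Paratop.coneNhds F (n + 1)) : g.1 ∈ F n * (F n)⁻¹ := by
  obtain ⟨-, -, a, ha, b, hb, h⟩ := hg
  rw [h]
  refine hF.mul_inv.mul_mem ⟨a, ha, 1, ?_, by simp⟩ (hF.scaledBall_subset _ _ hb)
  simpa using hF.one_mem (n + 1)

theorem not_half_pow_le_zero (j : ℕ) : ¬ (1 / 2 : ℚ) ^ j ≤ 0 := not_le.2 (by positivity)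

theorem mk_one_mem_coneNhds {n : ℕ} {h : H} : (h, 1) ∈ coneNhds F n ↔ h ∈ F n := by
  constructor
  · rintro ⟨-, -, a, ha, b, ⟨-, rfl⟩ | ⟨j, hj, -⟩, rfl⟩
    · simpa using ha
    · exact absurd hj (not_half_pow_le_zero j)
  · intro hh
    exact ⟨le_rfl, by simp, h, hh, 1, .inl (by simp), by simp⟩

theorem eq_zero_of_forall_lt_half_pow {t : ℚ} (h0 : 0 ≤ t) (h : ∀ n : ℕ, t < (1 / 2) ^ n) :
    t = 0 := by
  by_contra hne
  obtain ⟨n, hn⟩ := exists_pow_lt_of_lt_one (lt_of_le_of_ne h0 (Ne.symm hne))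
    (by norm_num : (1 / 2 : ℚ) < 1)
  exact absurd (h n) (not_lt.2 hn.le)

theorem IsInvariantSeq.eq_one_of_forall_mem_coneNhds
    (hone : ∀ h, (∀ n, h ∈ F n) → h = 1) {g : H × Multiplicative ℚ}
    (hg : ∀ n, g ∈ Paratop.coneNhds F n) : g = 1 := by
  obtain ⟨h, t⟩ := g
  obtain rfl : t = 1 := eq_zero_of_forall_lt_half_pow (hg 0).1 fun n => (hg n).2.1
  exact Prod.ext (hone h fun n => mk_one_mem_coneNhds.1 (hg n)) rfl

/-- The inverse has height `2⁻⁽ⁿ⁺¹⁾ - t` with `t < 2⁻⁽ⁿ⁺²⁾`, so at least `2⁻⁽ⁿ⁺²⁾`; at that height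
the slice contains the symmetric set `N (n + 2 + n)`, where `w.1` lies. -/
theorem IsInvariantSeq.inv_mem_coneNhds (hF : IsInvariantSeq F) (n : ℕ)
    {w : H × Multiplicative ℚ} (hw : w ∈ Paratop.coneNhds F (n + 2 + n + 1)) :
    ((1, .ofAdd (-(1 / 2) ^ (n + 1))) * w)⁻¹ ∈ Paratop.coneNhds F n := by
  have h0 := hw.1
  have h1 := hw.2.1
  have hpow : (1 / 2 : ℚ) ^ (n + 2 + n + 1) ≤ (1 / 2) ^ (n + 2) :=
    pow_le_pow_of_le_one (by norm_num) (by norm_num) (by omega)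
  have hpos : (0 : ℚ) < (1 / 2) ^ n := by positivity
  have e1 : (1 / 2 : ℚ) ^ (n + 1) = (1 / 2) ^ n * (1 / 2) := pow_succ _ _
  have e2 : (1 / 2 : ℚ) ^ (n + 2) = (1 / 2) ^ n * (1 / 4) := by rw [pow_add]; norm_num
  have ht : (((1 : H), Multiplicative.ofAdd (-(1 / 2 : ℚ) ^ (n + 1))) * w)⁻¹.2.toAdd =
      (1 / 2) ^ (n + 1) - w.2.toAdd := by
    simp; ring
  refine ⟨?_, ?_, 1, hF.one_mem n, w.1⁻¹, .inr ⟨n + 2, ?_, ?_⟩, by simp⟩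
  · rw [ht]; linarith
  · rw [ht]; linarith
  · rw [ht]; linarith
  · exact inv_mem_mul_inv (hF.mul_inv.mem_of_le (by omega) (hF.fst_mem_of_mem_coneNhds hw))

/-- This bounds the closure of a cone. Of the two indices lost, one pays for a product in `N`, the
other for doubling the radius. -/
theorem IsInvariantSeq.mem_coneNhds_of_forall (hF : IsInvariantSeq F)
    (hclosed : ∀ n h, (∀ k, ∃ c ∈ F k * (F k)⁻¹, h * c ∈ F n) → h ∈ F n) (n : ℕ)
    {g : H × Multiplicative ℚ}
    (hg : ∀ k, ∃ w ∈ Paratop.coneNhds F k, g * w ∈ Paratop.coneNhds F (n + 2)) :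
    g ∈ Paratop.coneNhds F n := by
  have hN := hF.mul_inv
  obtain ⟨h, x⟩ := g
  replace hg : ∀ k, ∃ c, ∃ y : ℚ, (c, Multiplicative.ofAdd y) ∈ Paratop.coneNhds F k ∧
      0 ≤ y ∧ y < (1 / 2) ^ k ∧ 0 ≤ x.toAdd + y ∧ x.toAdd + y < (1 / 2) ^ (n + 2) ∧
        ∃ a ∈ F (n + 2), ∃ b ∈ scaledBall F (n + 2) (x.toAdd + y), h * c = a * b := fun k => by
    obtain ⟨⟨c, y⟩, hw, h0, h1, h2⟩ := hg k
    exact ⟨c, y, hw, hw.1, hw.2.1, h0, h1, h2⟩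
  have hx0 : 0 ≤ x.toAdd := by
    by_contra! hx
    obtain ⟨k, hk⟩ := exists_pow_lt_of_lt_one (neg_pos.2 hx) (by norm_num : (1 / 2 : ℚ) < 1)
    obtain ⟨c, y, -, h0, h1, h2, -⟩ := hg k
    linarith
  have hx1 : x.toAdd < (1 / 2) ^ n := by
    obtain ⟨c, y, -, h0, h1, h2, h3, -⟩ := hg 0
    have : (1 / 2 : ℚ) ^ (n + 2) ≤ (1 / 2) ^ n :=
      pow_le_pow_of_le_one (by norm_num) (by norm_num) (by omega)
    linarith
  -- At height `0`, `2⁻ʲ ≤ y < 2⁻⁽ᵏ⁺²⁾` makes `b` small, so `h (c b⁻¹) = a` with `c b⁻¹ ∈ N k`, and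
  -- `hclosed` applies.
  rcases hx0.eq_or_lt with hx | hx
  · obtain rfl : x = 1 := hx.symm
    refine mk_one_mem_coneNhds.2 (hF.mem_of_le (Nat.le_add_right n 2) (hclosed _ _ fun k => ?_))
    obtain ⟨c, y, hw, h0, h1, -, -, a, ha, b, hb, hab⟩ := hg (k + 2)
    have hb' : b ∈ F (k + 1) * (F (k + 1))⁻¹ := by
      rcases hb with ⟨-, rfl⟩ | ⟨j, hj, hb⟩
      · exact hN.one_mem _
      · refine hN.mem_of_le ?_ hb
        rw [toAdd_one, zero_add] at hj
        have := (pow_lt_pow_iff_right_of_lt_one₀ (by norm_num) (by norm_num)).1 (hj.trans_lt h1)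
        omega
    refine ⟨c * b⁻¹, hN.mul_mem (hF.fst_mem_of_mem_coneNhds hw) (inv_mem_mul_inv hb'), ?_⟩
    rwa [← mul_assoc, hab, mul_inv_cancel_right]
  -- At positive height `c⁻¹` is absorbed into the ball: `y < x` gives `2⁻ʲ < 2x`, hence the radius
  -- index `min i j + 1`.
  · obtain ⟨i, hi⟩ := exists_pow_lt_of_lt_one hx (by norm_num : (1 / 2 : ℚ) < 1)
    obtain ⟨c, y, hw, h0, h1, -, -, a, ha, b, hb, hab⟩ := hg (i + (n + 2) + 1)
    have hyx : y < x.toAdd := h1.trans <| lt_of_le_of_lt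
      (pow_le_pow_of_le_one (by norm_num) (by norm_num) (by omega)) hi
    rcases hb with ⟨hxy, -⟩ | ⟨j, hj, hb⟩
    · linarith
    refine ⟨hx0, hx1, a, hF.mem_of_le (Nat.le_add_right n 2) ha, b * c⁻¹,
      .inr ⟨min i j + 1, ?_, ?_⟩, by rw [← mul_assoc, ← hab, mul_inv_cancel_right]⟩
    · rw [pow_succ]
      have hpos : (0 : ℚ) < (1 / 2) ^ i := by positivity
      rcases le_total i j with hij | hij
      · rw [min_eq_left hij]
        linarith
      · rw [min_eq_right hij]
        linarith
    · rw [show min i j + 1 + n = min i j + (n + 1) by omega]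
      exact hN.mul_mem (hN.mem_of_le (by omega) hb)
        (inv_mem_mul_inv (hN.mem_of_le (by omega) (hF.fst_mem_of_mem_coneNhds hw)))

end Extension

/-! ### The embedding and the equivalence -/

/-- Every first-countable `♭`-regular SIN-group embeds as a `♭`-closed subgroup of countable index
into a regular first-countable saturated SIN-group. -/
theorem IsFlatRegular.exists_saturated_extension {H : Type u} [Group H] [TopologicalSpace H]
    [ContinuousMul H] [T1Space H] [FirstCountableTopology H] (hreg : IsFlatRegular H)
    (hSIN : IsSIN H) :
    ∃ (G : Type u) (_ : Group G) (_ : TopologicalSpace G),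
      ContinuousMul G ∧ T3Space G ∧ FirstCountableTopology G ∧ IsSaturated G ∧ IsSIN G ∧
      ∃ φ : H →* G, IsEmbedding φ ∧ IsFlatClosed (φ.range : Set G) ∧ #(G ⧸ φ.range) = ℵ₀ := by
  obtain ⟨F, hF, hbasis, hFc⟩ := hreg.exists_invariantSeq hSIN
  have hone : ∀ h, (∀ n, h ∈ F n) → h = 1 := fun h hh => by
    by_contra hne
    obtain ⟨n, hn⟩ := hbasis.mem_iff.1 (isOpen_compl_singleton.mem_nhds (Ne.symm hne))
    exact hn (hh n) rfl
  have hclosed : ∀ n h, (∀ k, ∃ c ∈ F k * (F k)⁻¹, h * c ∈ F n) → h ∈ F n := fun n h hh => by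
    refine (hFc n).mem_of_forall fun V hV => ?_
    obtain ⟨k, hk⟩ := hbasis.mem_iff.1 hV
    obtain ⟨_, ⟨a, ha, b, hb, rfl⟩, hc⟩ := hh k
    exact ⟨a, hk ha, b⁻¹, hk (Set.mem_inv.1 hb), by simpa using hc⟩
  have hW := hF.coneNhds
  -- The cone topology, not the product topology.
  let τ : TopologicalSpace (H × Multiplicative ℚ) := hW.topology
  have hT0 : T0Space (H × Multiplicative ℚ) :=
    hW.t0Space fun g hg => IsInvariantSeq.eq_one_of_forall_mem_coneNhds hone hg
  have hR : RegularSpace (H × Multiplicative ℚ) :=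
    hW.regularSpace fun n => ⟨n + 2, fun g hg => hF.mem_coneNhds_of_forall hclosed n hg⟩
  have hrange : (MonoidHom.inl H (Multiplicative ℚ)).range = (MonoidHom.snd H _).ker := by
    ext ⟨h, t⟩
    rw [MonoidHom.mem_range, MonoidHom.mem_ker]
    simp [eq_comm]
  refine ⟨H × Multiplicative ℚ, inferInstance, τ, hW.continuousMul, {},
    hW.firstCountableTopology, hW.isSaturated fun n => ⟨_, _, fun w => hF.inv_mem_coneNhds n⟩,
    hW.isSIN, MonoidHom.inl H _, ⟨isInducing_iff_nhds.2 fun x => ?_, fun x y h => ?_⟩, ?_, ?_⟩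
  · refine Filter.ext fun s => ?_
    rw [mem_nhds_iff_left_translate, hbasis.mem_iff,
      ((hW.hasBasis_nhds (MonoidHom.inl H _ x)).toHasBasis.comap _).mem_iff]
    refine exists_congr fun n => ?_
    have : MonoidHom.inl H (Multiplicative ℚ) ⁻¹'
        {y | (MonoidHom.inl H _ x)⁻¹ * y ∈ Paratop.coneNhds F n} = {y | x⁻¹ * y ∈ F n} := by
      ext y
      simpa using mk_one_mem_coneNhds (F := F) (h := x⁻¹ * y)
    rw [this, true_and]
    exact ⟨fun h y hy => by simpa using h hy, fun h y hy => h (by simpa using hy)⟩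
  · simpa using h
  -- Heights in the `n`-th cone lie in `[0, 2⁻ⁿ)`, so the projection is continuous into the
  -- Hausdorff group `ℚ`, where points are ♭-closed.
  · have hsnd : Continuous (MonoidHom.snd H (Multiplicative ℚ)) := by
      refine continuous_ofAdd.comp (g := Multiplicative.ofAdd)
        (f := fun g : H × Multiplicative ℚ => g.2.toAdd)
        (continuous_iff_continuousAt.2 fun g => ?_)
      refine ((hW.hasBasis_nhds g).tendsto_iff (nhds_basis_Ioo_pos _)).2 fun ε hε => ?_
      obtain ⟨n, hn⟩ := exists_pow_lt_of_lt_one hε (by norm_num : (1 / 2 : ℚ) < 1)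
      refine ⟨n, trivial, fun y hy => ?_⟩
      obtain ⟨h0, h1, -⟩ := hy
      simp only [Prod.snd_mul, Prod.snd_inv, toAdd_mul, toAdd_inv] at h0 h1
      constructor <;> linarith
    have : (MonoidHom.range (MonoidHom.inl H (Multiplicative ℚ)) :
        Set (H × Multiplicative ℚ)) =
        MonoidHom.snd H _ ⁻¹' {1} := by
      rw [hrange]
      rfl
    rw [this]
    exact (isClosed_singleton.isFlatClosed).preimage _ hsnd
  · have e := (QuotientGroup.quotientKerEquivOfSurjective
      (MonoidHom.snd H (Multiplicative ℚ)) Prod.snd_surjective).toEquiv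
    rw [hrange]
    have : Countable (Multiplicative ℚ) := inferInstanceAs (Countable ℚ)
    have : Infinite (Multiplicative ℚ) := inferInstanceAs (Infinite ℚ)
    have := e.countable_iff.2 ‹_›
    have := e.infinite_iff.2 ‹_›
    exact Cardinal.mk_eq_aleph0 _

end Paratop

theorem corollary4 {H : Type u} [Group H] [TopologicalSpace H] [ContinuousMul H] [T2Space H]
    [FirstCountableTopology H] (hSIN : Paratop.IsSIN H) :
    Paratop.IsFlatRegular H ↔
      ∃ (G : Type u) (_ : Group G) (_ : TopologicalSpace G),
        ContinuousMul G ∧ T3Space G ∧ FirstCountableTopology G ∧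
        Paratop.IsSaturated G ∧ Paratop.IsSIN G ∧
        ∃ φ : H →* G, IsEmbedding φ ∧ Paratop.IsFlatClosed (φ.range : Set G) ∧
          #(G ⧸ φ.range) = ℵ₀ := by
  refine ⟨fun hreg => hreg.exists_saturated_extension hSIN, ?_⟩
  rintro ⟨G, _, _, _, _, -, hsat, hG, φ, hφ, -, -⟩
  exact (hsat.isFlatRegular hG).of_isInducing φ hφ.isInducing
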